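/- Let $k$ be a field and let $e\ge 4$, $q\ge 1$, $d\ge 1$ be integers. Put $m=e+2q+1$ and assume $\gcd(m,d)=1$. Let $\Gamma=\Gamma_{(e,q,d)}(\mathcal S)$ be the numerical semigroup generated by $$\mathcal S=\{m,\ m+d\}\cup\{(q+1)m+(q+i)d \mid 2\le i\le e-1\},$$ let $R=k[[\Gamma]]\subseteq k[[t]]$ be the ring of power series all of whose exponents lie in $\Gamma$, with maximal ideal $\mathfrak m$, and let $I=(t^m)\subseteq R$. Let $G_{\mathfrak m}=\bigoplus_{n\ge 0}\mathfrak m^n/\mathfrak m^{n+1}$ be the tangent cone of $R$ and $F(I)=\bigoplus_{n\ge 0}I^n/\mathfrak m I^n$ the fiber cone of $I$; $G_{\mathfrak m}$ is a graded $F(I)$-module through the natural graded ring homomorphism $F(I)\to G_{\mathfrak m}$ induced by the inclusions $I^n\subseteq\mathfrak m^n$. Write $(t^m)^*\in F(I)_1=I/\mathfrak m I$ for the class of $t^m$, and $M(-b)$ for the graded module $M$ shifted so that $M(-b)_n=M_{n-b}$ (which is $0$ for $n<b$). Then $G_{\mathfrak m}$ is not a free $F(I)$-module, and there is an isomorphism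 of graded $F(I)$-modules $$\begin{aligned}G_{\mathfrak m}\;\cong\;& F(I)\ \oplus\ \bigoplus_{i=1}^{q+1}F(I)(-i)\\&\oplus\ \bigoplus_{i=1}^{q+2}\left(F(I)\bigl(-(e+q+i-2)\bigr)\oplus\frac{F(I)}{((t^m)^*)^{e-2}F(I)}(-i)\right)\\&\oplus\ \bigoplus_{i=1}^{e-3}\left(F(I)\bigl(-(q+i+1)\bigr)\oplus\frac{F(I)}{((t^m)^*)^{i}F(I)}(-1)\right).\end{aligned}$$ -/

import Mathlib

open Polynomial

/-! ### Fiber cones and the tangent cone of a local ring -/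

section Cones

variable {R : Type*} [CommRing R] [IsLocalRing R]

/-- The fiber cone `F(I) = ⨁ₙ Iⁿ / 𝔪 Iⁿ` of an ideal `I` of a local ring `(R, 𝔪)`, realised as
the quotient `R[It] / 𝔪 R[It]` of the Rees algebra `R[It] = ⨁ₙ Iⁿ tⁿ`. -/
def FiberCone (I : Ideal R) : Type _ :=
  reesAlgebra I ⧸ (IsLocalRing.maximalIdeal R).map (algebraMap R (reesAlgebra I))

noncomputable instance (I : Ideal R) : CommRing (FiberCone I) :=
  inferInstanceAs (CommRing
    (reesAlgebra I ⧸ (IsLocalRing.maximalIdeal R).map (algebraMap R (reesAlgebra I))))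

noncomputable instance (I : Ideal R) : Algebra R (FiberCone I) :=
  inferInstanceAs (Algebra R
    (reesAlgebra I ⧸ (IsLocalRing.maximalIdeal R).map (algebraMap R (reesAlgebra I))))

/-- The quotient map `R[It] → F(I)`. -/
noncomputable def FiberCone.mk (I : Ideal R) : reesAlgebra I →ₐ[R] FiberCone I :=
  Ideal.Quotient.mkₐ R ((IsLocalRing.maximalIdeal R).map (algebraMap R (reesAlgebra I)))

/-- The degree `n` part `Iⁿ tⁿ` of the Rees algebra `R[It]`. -/
noncomputable def reesPiece (I : Ideal R) (n : ℕ) : Submodule R (reesAlgebra I) :=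
  (LinearMap.range (Polynomial.monomial (R := R) n)).comap (reesAlgebra I).val.toLinearMap

/-- The degree `n` part of the fiber cone: the image of `Iⁿ tⁿ`. -/
noncomputable def FiberCone.piece (I : Ideal R) (n : ℕ) : Submodule R (FiberCone I) :=
  (reesPiece I n).map (FiberCone.mk I).toLinearMap

/-- The class `x* ∈ I / 𝔪 I = F(I)₁` of an element `x ∈ I`. -/
noncomputable def FiberCone.degreeOne (I : Ideal R) (x : R) (hx : x ∈ I) : FiberCone I :=
  FiberCone.mk I
    ⟨Polynomial.monomial 1 x, reesAlgebra.monomial_mem.2 (by simpa using hx)⟩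

variable (R) in
/-- The tangent cone (associated graded ring) `G_𝔪(R) = ⨁ₙ 𝔪ⁿ / 𝔪ⁿ⁺¹` of a local ring `(R, 𝔪)`,
that is `R[𝔪t] / 𝔪 R[𝔪t]`. -/
def TangentCone : Type _ := FiberCone (IsLocalRing.maximalIdeal R)

noncomputable instance : CommRing (TangentCone R) :=
  inferInstanceAs (CommRing (FiberCone (IsLocalRing.maximalIdeal R)))

noncomputable instance : Algebra R (TangentCone R) :=
  inferInstanceAs (Algebra R (FiberCone (IsLocalRing.maximalIdeal R)))

variable (R) in
/-- The degree `n` part `𝔪ⁿ / 𝔪ⁿ⁺¹` of the tangent cone. -/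
noncomputable def TangentCone.piece (n : ℕ) : Submodule R (TangentCone R) :=
  FiberCone.piece (IsLocalRing.maximalIdeal R) n

/-- The class of `f ∈ R[It]` in the fiber cone vanishes iff every coefficient of `tⁿ` in `f` lies
in `𝔪 Iⁿ`: so the part of degree `n` of `F(I)` is `Iⁿ / 𝔪 Iⁿ` (and that of `G_𝔪(R)` is
`𝔪ⁿ / 𝔪ⁿ⁺¹`), and these parts form a direct sum. -/
theorem FiberCone.mk_eq_zero_iff (I : Ideal R) (f : reesAlgebra I) :
    FiberCone.mk I f = 0 ↔
      ∀ n, (f : R[X]).coeff n ∈ IsLocalRing.maximalIdeal R * I ^ n := by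
  refine Iff.trans Ideal.Quotient.eq_zero_iff_mem ?_
  constructor
  · intro hf
    induction hf using Submodule.span_induction with
    | mem x hx =>
      obtain ⟨a, ha, rfl⟩ := hx
      intro n
      have h : ((algebraMap R (reesAlgebra I) a : reesAlgebra I) : R[X]) = C a := rfl
      rw [h, coeff_C]
      split_ifs with h0
      · subst h0; simpa using ha
      · exact zero_mem _
    | zero => simp
    | add x y _ _ hx hy => exact fun n => by simpa using add_mem (hx n) (hy n)
    | smul a x _ hx =>
      intro n
      rw [smul_eq_mul, MulMemClass.coe_mul, coeff_mul]
      refine sum_mem fun p hp => ?_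
      have h1 := Ideal.mul_mem_mul (a.2 p.1) (hx p.2)
      rwa [mul_left_comm, ← pow_add, Finset.HasAntidiagonal.mem_antidiagonal.1 hp] at h1
  · intro h
    have key : ∀ (n : ℕ) (c : R), c ∈ IsLocalRing.maximalIdeal R * I ^ n →
        ∃ g ∈ (IsLocalRing.maximalIdeal R).map (algebraMap R (reesAlgebra I)),
          (g : R[X]) = Polynomial.monomial n c := by
      intro n c hc
      induction hc using Submodule.mul_induction_on' with
      | mem_mul_mem a ha b hb =>
        refine ⟨algebraMap R (reesAlgebra I) a *
          ⟨Polynomial.monomial n b, reesAlgebra.monomial_mem.2 hb⟩,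
          Ideal.mul_mem_right _ _ (Ideal.mem_map_of_mem _ ha), ?_⟩
        change C a * Polynomial.monomial n b = _
        rw [C_mul_monomial]
      | add x _ y _ hx hy =>
        obtain ⟨g, hg, hgx⟩ := hx
        obtain ⟨g2, hg2, hgy⟩ := hy
        exact ⟨g + g2, add_mem hg hg2, by rw [map_add, ← hgx, ← hgy]; rfl⟩
    choose! g hg hgc using key
    have hf : f = ∑ n ∈ (f : R[X]).support, g n ((f : R[X]).coeff n) := by
      apply Subtype.ext
      rw [AddSubmonoidClass.coe_finsetSum, Finset.sum_congr rfl fun n _ => hgc n _ (h n)]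
      exact (f : R[X]).as_sum_support
    rw [hf]
    exact sum_mem fun n _ => hg n _ (h n)

/-- The natural ring homomorphism `F(I) → G_𝔪(R)` for `I ⊆ 𝔪`, given in degree `n` by the map
`Iⁿ / 𝔪 Iⁿ → 𝔪ⁿ / 𝔪ⁿ⁺¹` that the inclusion `Iⁿ ⊆ 𝔪ⁿ` induces. -/
noncomputable def FiberCone.toTangentCone {I : Ideal R} (hI : I ≤ IsLocalRing.maximalIdeal R) :
    FiberCone I →+* TangentCone R :=
  Ideal.quotientMap _
    (Subalgebra.inclusion (show reesAlgebra I ≤ reesAlgebra (IsLocalRing.maximalIdeal R) from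
      fun _ hf i => Ideal.pow_right_mono hI i (hf i))).toRingHom
    (Ideal.map_le_iff_le_comap.2 fun _ ha => Ideal.mem_map_of_mem _ ha)

/-- The grading of `M(-b)`, for a graded module `M` with homogeneous parts `P n`:
`M(-b)ₙ = Mₙ₋ᵦ`, which is `0` for `n < b`. -/
def shiftPiece {M : Type*} [AddCommGroup M] [Module R M] (P : ℕ → Submodule R M) (b n : ℕ) :
    Submodule R M :=
  if b ≤ n then P (n - b) else ⊥

/-- The degree `n` part of the quotient `F(I) / J`: the image of the degree `n` part of `F(I)`. -/
noncomputable def FiberCone.quotPiece {I : Ideal R} (J : Ideal (FiberCone I)) (n : ℕ) :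
    Submodule R (FiberCone I ⧸ J) :=
  (FiberCone.piece I n).map (Ideal.Quotient.mkₐ R J).toLinearMap

end Cones

/-! ### Semigroup rings -/

section SemigroupRing

variable (k : Type*) [Field k] (Γ : AddSubmonoid ℕ)

/-- The ring `k[[Γ]] = k[[t^{a₁}, …, t^{aₑ}]]` of a semigroup `Γ = ⟨a₁, …, aₑ⟩`: the power series in
`t` all of whose exponents lie in `Γ`. -/
def semigroupRing : Subalgebra k (PowerSeries k) where
  carrier := {f | ∀ n, n ∉ Γ → PowerSeries.coeff n f = 0}
  mul_mem' := by
    intro f g hf hg n hn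
    rw [PowerSeries.coeff_mul]
    refine Finset.sum_eq_zero fun p hp => ?_
    by_cases h1 : p.1 ∈ Γ
    · have h2 : p.2 ∉ Γ := fun h2 => hn (Finset.HasAntidiagonal.mem_antidiagonal.1 hp ▸ Γ.add_mem h1 h2)
      rw [hg _ h2, mul_zero]
    · rw [hf _ h1, zero_mul]
  add_mem' := by
    intro f g hf hg n hn
    rw [map_add, hf n hn, hg n hn, add_zero]
  algebraMap_mem' := by
    intro c n hn
    have h0 : n ≠ 0 := fun h => hn (by rw [h]; exact Γ.zero_mem)
    change PowerSeries.coeff n (PowerSeries.C c) = 0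
    rw [PowerSeries.coeff_C, if_neg h0]

variable {k Γ}

theorem semigroupRing.isUnit_iff (f : semigroupRing k Γ) :
    IsUnit f ↔ PowerSeries.constantCoeff (f : PowerSeries k) ≠ 0 := by
  constructor
  · intro h
    have h1 : IsUnit (f : PowerSeries k) := h.map (semigroupRing k Γ).val
    exact (PowerSeries.isUnit_iff_constantCoeff.1 h1).ne_zero
  · intro h
    have hinv : (f : PowerSeries k)⁻¹ ∈ semigroupRing k Γ := by
      intro n
      induction n using Nat.strong_induction_on with
      | _ n ih =>
        intro hn
        have h0 : n ≠ 0 := fun h => hn (by rw [h]; exact Γ.zero_mem)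
        rw [PowerSeries.coeff_inv, if_neg h0]
        refine mul_eq_zero_of_right _ (Finset.sum_eq_zero fun p hp => ?_)
        split_ifs with hlt
        · by_cases h1 : p.1 ∈ Γ
          · have h2 : p.2 ∉ Γ := fun h2 => hn (Finset.HasAntidiagonal.mem_antidiagonal.1 hp ▸ Γ.add_mem h1 h2)
            rw [ih _ hlt h2, mul_zero]
          · rw [f.2 _ h1, zero_mul]
        · rfl
    refine IsUnit.of_mul_eq_one ⟨_, hinv⟩ (Subtype.ext ?_)
    exact PowerSeries.mul_inv_cancel _ h

instance : IsLocalRing (semigroupRing k Γ) :=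
  IsLocalRing.of_isUnit_or_isUnit_one_sub_self fun f => by
    rw [semigroupRing.isUnit_iff, semigroupRing.isUnit_iff]
    by_contra! h
    have h1 : PowerSeries.constantCoeff ((1 - f : semigroupRing k Γ) : PowerSeries k) = 0 := h.2
    rw [AddSubgroupClass.coe_sub, map_sub, h.1] at h1
    simp at h1

variable (k) in
/-- The element `t^s` of `k[[Γ]]`, for `s ∈ Γ`. -/
noncomputable def semigroupRing.tpow {s : ℕ} (hs : s ∈ Γ) : semigroupRing k Γ :=
  ⟨PowerSeries.X ^ s, fun n hn => by
    rw [PowerSeries.coeff_X_pow, if_neg (fun h : n = s => hn (by rw [h]; exact hs))]⟩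

theorem semigroupRing.span_tpow_le {s : ℕ} (hs : s ∈ Γ) (h0 : s ≠ 0) :
    Ideal.span {semigroupRing.tpow k hs} ≤ IsLocalRing.maximalIdeal (semigroupRing k Γ) := by
  rw [Ideal.span_singleton_le_iff_mem, IsLocalRing.mem_maximalIdeal, mem_nonunits_iff,
    semigroupRing.isUnit_iff]
  simp [semigroupRing.tpow, h0]

end SemigroupRing

/-! ### The symmetric class -/

section Symmetric

/-- The multiplicity `m = e + 2q + 1`. -/
def symMult (e q : ℕ) : ℕ := e + 2 * q + 1

/-- The generators `m`, `m + d` and `(q+1)m + (q+i)d` for `2 ≤ i ≤ e - 1`. -/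
def symGens (e q d : ℕ) : Set ℕ :=
  {symMult e q, symMult e q + d} ∪
    {x | ∃ i, 2 ≤ i ∧ i ≤ e - 1 ∧ x = (q + 1) * symMult e q + (q + i) * d}

/-- The numerical semigroup `Γ_{(e,q,d)}(𝒮)`. -/
def symSemigroup (e q d : ℕ) : AddSubmonoid ℕ := AddSubmonoid.closure (symGens e q d)

theorem symMult_mem (e q d : ℕ) : symMult e q ∈ symSemigroup e q d :=
  AddSubmonoid.subset_closure (Or.inl (Or.inl rfl))

variable (k : Type*) [Field k] (e q d : ℕ)

/-- The local ring `k[[Γ_{(e,q,d)}(𝒮)]]`. -/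
def SymRing : Type _ := semigroupRing k (symSemigroup e q d)

noncomputable instance : CommRing (SymRing k e q d) :=
  inferInstanceAs (CommRing (semigroupRing k (symSemigroup e q d)))

instance : IsLocalRing (SymRing k e q d) :=
  inferInstanceAs (IsLocalRing (semigroupRing k (symSemigroup e q d)))

/-- The element `t^m`. -/
noncomputable def symT : SymRing k e q d := semigroupRing.tpow k (symMult_mem e q d)

/-- The ideal `I = (t^m)`. -/
noncomputable def symIdeal : Ideal (SymRing k e q d) :=
  Ideal.span {symT k e q d}

theorem symIdeal_le : symIdeal k e q d ≤ IsLocalRing.maximalIdeal (SymRing k e q d) :=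
  semigroupRing.span_tpow_le (Γ := symSemigroup e q d) (symMult_mem e q d) (Nat.succ_ne_zero _)

/-- The tangent cone is an algebra over the fiber cone `F(I)`, `I = (t^m)`, through the natural
map `F(I) → G_𝔪`. -/
noncomputable instance : Algebra (FiberCone (symIdeal k e q d)) (TangentCone (SymRing k e q d)) :=
  (FiberCone.toTangentCone (symIdeal_le k e q d)).toAlgebra

/-- The ideal `((t^m)*)^c F(I)` of the fiber cone. -/
noncomputable def symTorsion (c : ℕ) : Ideal (FiberCone (symIdeal k e q d)) :=
  Ideal.span {FiberCone.degreeOne (symIdeal k e q d) (symT k e q d)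
    (Ideal.mem_span_singleton_self _) ^ c}

end Symmetric

/-!
Everything is read off from monomials. By coprimality of `m` and `d`, every element of the
semigroup `Γ` is `a m + b d` for a unique pair `(a, b)` with `b < m`. Such an element is a sum of at
least `n` generators exactly when `OrderGe e q n a b` holds: either `n, b ≤ a`, using only the
generators `m` and `m + d`, or one of the other generators is used, in place of `q + 1` of those two,
which costs `q` summands but allows `a < b`. Using two or more of the others gives nothing new, and
neither does the relation `m d = d m`; both are contained in the fact that the resulting filtration
is multiplicative (`add_mem_symFiltration`). Hence the order of `a m + b d` is `a` for `b ≤ a` and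
`a - q` for `a < b`, and `𝔪ⁿ` is the set of power series with exponents of order at least `n`
(`mem_maximalIdeal_pow_iff`).

So `G_𝔪` has a `k`-basis indexed by `Γ`, with coordinates `tangentCoeff`, while `F(I)` is the
polynomial ring `k[X]` in `X = (t^m)*` (`polyEquivFiber`). Multiplication by `X` raises `a` by one,
and it gives zero when the order jumps by more than one (`tangentCoeff_smul_gen`). The order is
`a - q` up to `a = b - 1` and `a` from `a = b` on, so in the residue class of `b d` modulo `m` there
is exactly one jump if `b ≥ q + 2`, and none if `b ≤ q + 1`. The monomials with `a ≥ b` span a free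
module generated in degree `b`. Those with `a < b` start at `a = max (q + 1) (b - (e - 2))`, the
smallest `a` that occurs, and span a copy of `F(I) / (X ^ c)` with `c = min (b - (q + 1)) (e - 2)`,
generated in degree `b - c - q`. The sum of all these maps is an isomorphism compatible with the
gradings (`decompositionMap_injective`, `decompositionMap_surjective`,
`decompositionMap_mem_piece_iff`). Sorting the classes `b` into `0`, `1 ≤ b ≤ q + 1`,
`q + 2 ≤ b ≤ e + q - 2` and `b ≥ e + q - 1` gives the stated summands. The torsion summand for
`b = q + 2` shows that `G_𝔪` is not free over the domain `F(I)`.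
-/

/-! ### Homogeneous classes and functionals on fiber cones -/

section Cones

variable {R : Type*} [CommRing R] [IsLocalRing R]

/-- The class in `Jⁿ / 𝔪 Jⁿ` of an element `r ∈ Jⁿ`, as an element of the fiber cone of `J`. -/
noncomputable def FiberCone.cls (J : Ideal R) (n : ℕ) (r : R) (hr : r ∈ J ^ n) : FiberCone J :=
  FiberCone.mk J ⟨Polynomial.monomial n r, reesAlgebra.monomial_mem.2 hr⟩

theorem FiberCone.mk_surjective (J : Ideal R) : Function.Surjective (FiberCone.mk J) :=
  Ideal.Quotient.mk_surjective

theorem FiberCone.mem_piece_iff {J : Ideal R} {n : ℕ} {x : FiberCone J} :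
    x ∈ FiberCone.piece J n ↔ ∃ r, ∃ hr : r ∈ J ^ n, x = FiberCone.cls J n r hr := by
  constructor
  · rintro ⟨f, ⟨r, hr⟩, rfl⟩
    have hr' : Polynomial.monomial n r = (f : R[X]) := hr
    have hm : r ∈ J ^ n := by
      have h := f.2
      rw [← hr'] at h
      exact reesAlgebra.monomial_mem.1 h
    exact ⟨r, hm, congrArg (FiberCone.mk J) (Subtype.ext hr'.symm)⟩
  · rintro ⟨r, hr, rfl⟩
    exact ⟨_, ⟨r, rfl⟩, rfl⟩

theorem FiberCone.cls_congr {J : Ideal R} {n n' : ℕ} {r r' : R} {hr : r ∈ J ^ n} (hn : n = n')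
    (h : r = r') : FiberCone.cls J n r hr = FiberCone.cls J n' r' (hn ▸ h ▸ hr) := by
  subst hn h; rfl

theorem FiberCone.cls_mul {J : Ideal R} {n n' : ℕ} {r r' : R} (hr : r ∈ J ^ n)
    (hr' : r' ∈ J ^ n') :
    FiberCone.cls J n r hr * FiberCone.cls J n' r' hr' =
      FiberCone.cls J (n + n') (r * r') (by rw [pow_add]; exact Ideal.mul_mem_mul hr hr') := by
  refine (map_mul (FiberCone.mk J) _ _).symm.trans (congrArg _ (Subtype.ext ?_))
  exact Polynomial.monomial_mul_monomial _ _ _ _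

theorem FiberCone.algebraMap_eq_cls (J : Ideal R) (r : R) :
    algebraMap R (FiberCone J) r = FiberCone.cls J 0 r (by simp) :=
  rfl

theorem FiberCone.degreeOne_pow (J : Ideal R) (x : R) (hx : x ∈ J) (n : ℕ) :
    FiberCone.degreeOne J x hx ^ n = FiberCone.cls J n (x ^ n) (Ideal.pow_mem_pow hx n) := by
  refine (map_pow (FiberCone.mk J) _ n).symm.trans (congrArg _ (Subtype.ext ?_))
  change (Polynomial.monomial 1 x) ^ n = _
  rw [Polynomial.monomial_pow, one_mul]

/-- Every element of a fiber cone is the sum of its homogeneous components. -/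
theorem FiberCone.mk_eq_sum_cls (J : Ideal R) (f : reesAlgebra J) :
    FiberCone.mk J f = ∑ n ∈ (f : R[X]).support, FiberCone.cls J n ((f : R[X]).coeff n) (f.2 n) := by
  refine Eq.trans (congrArg _ (Subtype.ext ?_)) (map_sum (FiberCone.mk J) _ _)
  rw [AddSubmonoidClass.coe_finsetSum]
  exact (f : R[X]).as_sum_support

/-- An additive functional on `R` that vanishes on `𝔪 Jⁿ`, applied to the component of degree
`n` of an element of the fiber cone. -/
noncomputable def FiberCone.functional {A : Type*} [AddCommGroup A] (J : Ideal R) (n : ℕ)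
    (l : R →+ A) (hl : ∀ x ∈ IsLocalRing.maximalIdeal R * J ^ n, l x = 0) : FiberCone J →+ A :=
  QuotientAddGroup.lift
    (Submodule.toAddSubgroup
      ((IsLocalRing.maximalIdeal R).map (algebraMap R (reesAlgebra J))))
    (AddMonoidHom.mk' (fun f : reesAlgebra J => l ((f : R[X]).coeff n))
      fun f g => by
        change l (((f : R[X]) + (g : R[X])).coeff n) = _
        rw [Polynomial.coeff_add, map_add])
    fun f hf => hl _ ((FiberCone.mk_eq_zero_iff J f).1 (Ideal.Quotient.eq_zero_iff_mem.2 hf) n)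

theorem FiberCone.functional_mk {A : Type*} [AddCommGroup A] (J : Ideal R) (n : ℕ)
    (l : R →+ A) (hl : ∀ x ∈ IsLocalRing.maximalIdeal R * J ^ n, l x = 0) (f : reesAlgebra J) :
    FiberCone.functional J n l hl (FiberCone.mk J f) = l ((f : R[X]).coeff n) :=
  rfl

theorem FiberCone.functional_cls {A : Type*} [AddCommGroup A] (J : Ideal R) (n : ℕ)
    (l : R →+ A) (hl : ∀ x ∈ IsLocalRing.maximalIdeal R * J ^ n, l x = 0) (i : ℕ) (r : R)
    (hr : r ∈ J ^ i) :
    FiberCone.functional J n l hl (FiberCone.cls J i r hr) = if i = n then l r else 0 := by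
  refine (FiberCone.functional_mk J n l hl _).trans ?_
  change l ((Polynomial.monomial i r).coeff n) = _
  rw [Polynomial.coeff_monomial]
  split_ifs <;> simp

theorem FiberCone.cls_eq_zero_iff {J : Ideal R} {n : ℕ} {r : R} (hr : r ∈ J ^ n) :
    FiberCone.cls J n r hr = 0 ↔ r ∈ IsLocalRing.maximalIdeal R * J ^ n := by
  refine (FiberCone.mk_eq_zero_iff J _).trans ⟨fun h => ?_, fun h i => ?_⟩
  · simpa using h n
  · change (Polynomial.monomial n r).coeff i ∈ _
    rw [Polynomial.coeff_monomial]
    split_ifs with hi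
    · exact hi ▸ h
    · exact zero_mem _

theorem FiberCone.cls_add {J : Ideal R} {n : ℕ} {r r' : R} (hr : r ∈ J ^ n) (hr' : r' ∈ J ^ n) :
    FiberCone.cls J n (r + r') (add_mem hr hr') =
      FiberCone.cls J n r hr + FiberCone.cls J n r' hr' := by
  refine Eq.trans (congrArg (FiberCone.mk J) (Subtype.ext ?_)) (map_add (FiberCone.mk J) _ _)
  exact map_add (Polynomial.monomial n) _ _

end Cones

/-! ### The order filtration of the semigroup -/

section Semigroup

/-- The condition on `(a, b)`, for `b < m`, under which `a m + b d` is a sum of at least `n`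
generators: either only the generators `m` and `m + d` are used (and `b ≤ a`), or one of the
generators `(q+1) m + (q+i) d` is used, at a cost of `q` summands. -/
def OrderGe (e q n a b : ℕ) : Prop :=
  (n ≤ a ∧ b ≤ a) ∨ (n + q ≤ a ∧ q + 2 ≤ b ∧ q + 1 ≤ a ∧ b + 2 ≤ a + e)

/-- The set of the elements of the semigroup that are sums of at least `n` generators. -/
def symFiltration (e q d n : ℕ) : Set ℕ :=
  {s | ∃ a b, b < symMult e q ∧ OrderGe e q n a b ∧ s = a * symMult e q + b * d}

/-- The largest number of generators with sum `a m + b d`, when `b < m` and `a m + b d` lies in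
the semigroup. -/
def symOrder (q a b : ℕ) : ℕ := if b ≤ a then a else a - q

variable {e q d : ℕ}

theorem symMult_pos : 0 < symMult e q := Nat.succ_pos _

theorem not_orderGe_symOrder_add_one (a b : ℕ) : ¬ OrderGe e q (symOrder q a b + 1) a b := by
  unfold OrderGe symOrder
  split_ifs <;> omega

theorem symOrder_eq_of_orderGe {n a b : ℕ} (h : OrderGe e q n a b)
    (h' : ¬ OrderGe e q (n + 1) a b) : symOrder q a b = n := by
  unfold OrderGe at *
  unfold symOrder
  split_ifs <;> omega

theorem OrderGe.mono {n n' a b : ℕ} (h : OrderGe e q n a b) (hn : n' ≤ n) :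
    OrderGe e q n' a b := by
  unfold OrderGe at *; omega

/-- The representation `s = a m + b d` with `b < m` is unique. -/
theorem symRepr_unique (hmd : Nat.gcd (symMult e q) d = 1) {a b a' b' : ℕ}
    (hb : b < symMult e q) (hb' : b' < symMult e q)
    (h : a * symMult e q + b * d = a' * symMult e q + b' * d) : a = a' ∧ b = b' := by
  have h1 : b * d ≡ b' * d [MOD symMult e q] := by
    have := congrArg (· % symMult e q) h
    simpa [Nat.ModEq, Nat.add_mod] using this
  have h2 : b = b' :=
    Nat.ModEq.eq_of_lt_of_lt (Nat.ModEq.cancel_right_of_coprime hmd h1) hb hb'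
  subst h2
  exact ⟨Nat.eq_of_mul_eq_mul_right symMult_pos (Nat.add_right_cancel h), rfl⟩

theorem mem_symFiltration_iff (hmd : Nat.gcd (symMult e q) d = 1) {n a b : ℕ}
    (hb : b < symMult e q) :
    a * symMult e q + b * d ∈ symFiltration e q d n ↔ OrderGe e q n a b := by
  constructor
  · rintro ⟨a', b', hb', h, heq⟩
    obtain ⟨rfl, rfl⟩ := symRepr_unique hmd hb hb' heq
    exact h
  · exact fun h => ⟨a, b, hb, h, rfl⟩

theorem symFiltration_anti {n n' : ℕ} (hn : n' ≤ n) :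
    symFiltration e q d n ⊆ symFiltration e q d n' := by
  rintro s ⟨a, b, hb, h, rfl⟩
  exact ⟨a, b, hb, h.mono hn, rfl⟩

/-- The filtration is multiplicative. When `b + b' ≥ m`, the relation `m d = d m` rewrites the sum
as `(a + a' + d) m + (b + b' - m) d`. -/
theorem add_mem_symFiltration {n n' s s' : ℕ} (hs : s ∈ symFiltration e q d n)
    (hs' : s' ∈ symFiltration e q d n') : s + s' ∈ symFiltration e q d (n + n') := by
  obtain ⟨a, b, hb, h, rfl⟩ := hs
  obtain ⟨a', b', hb', h', rfl⟩ := hs'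
  by_cases hw : b + b' < symMult e q
  · refine ⟨a + a', b + b', hw, ?_, by ring⟩
    unfold OrderGe symMult at *
    omega
  · refine ⟨a + a' + d, b + b' - symMult e q, by omega, ?_, ?_⟩
    · unfold OrderGe symMult at *
      omega
    · obtain ⟨c, hc⟩ := Nat.exists_eq_add_of_le (not_lt.1 hw)
      rw [hc, Nat.add_sub_cancel_left]
      have : b * d + b' * d = (symMult e q + c) * d := by rw [← hc]; ring
      linear_combination this

/-- An element of order at least `n + 1` is the sum of one of order at least `1` and one of order
at least `n`. -/
theorem exists_add_of_mem_symFiltration (he : 4 ≤ e) {n s : ℕ}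
    (hs : s ∈ symFiltration e q d (n + 1)) :
    ∃ u ∈ symFiltration e q d 1, ∃ v ∈ symFiltration e q d n, s = u + v := by
  obtain ⟨a, b, hb, h, rfl⟩ := hs
  have hm : 1 < symMult e q := by unfold symMult; omega
  -- subtracting `m` (for `ε = 0`) or `m + d` (for `ε = 1`)
  have step : ∀ ε ≤ 1, ε ≤ b → 1 ≤ a → OrderGe e q n (a - 1) (b - ε) →
      ∃ u ∈ symFiltration e q d 1, ∃ v ∈ symFiltration e q d n,
        a * symMult e q + b * d = u + v := by
    intro ε hε hεb ha h
    refine ⟨1 * symMult e q + ε * d, ⟨1, ε, by omega, Or.inl ⟨le_rfl, hε⟩, rfl⟩,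
      (a - 1) * symMult e q + (b - ε) * d, ⟨_, _, by omega, h, rfl⟩, ?_⟩
    obtain ⟨a, rfl⟩ := Nat.exists_eq_add_of_le ha
    obtain ⟨b, rfl⟩ := Nat.exists_eq_add_of_le hεb
    simp only [Nat.add_sub_cancel_left]
    ring
  rcases n.eq_zero_or_pos with rfl | hn
  · exact ⟨_, ⟨a, b, hb, h, rfl⟩, 0, ⟨0, 0, by omega, Or.inl ⟨le_rfl, le_rfl⟩, by simp⟩, by simp⟩
  · have ha : 1 ≤ a := by unfold OrderGe at h; omega
    by_cases h0 : OrderGe e q n (a - 1) b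
    · exact step 0 zero_le_one (Nat.zero_le _) ha h0
    · refine step 1 le_rfl ?_ ha ?_ <;> unfold OrderGe at * <;> omega

theorem symFiltration_zero (he : 4 ≤ e) :
    symFiltration e q d 0 = (symSemigroup e q d : Set ℕ) := by
  have hgen : ∀ x ∈ symGens e q d, x ∈ symSemigroup e q d :=
    fun x hx => AddSubmonoid.subset_closure hx
  have h1 : ∀ c, c * symMult e q ∈ symSemigroup e q d := fun c => by
    simpa using AddSubmonoid.nsmul_mem _ (symMult_mem e q d) c
  have h2 : ∀ c, c * (symMult e q + d) ∈ symSemigroup e q d := fun c => by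
    simpa using AddSubmonoid.nsmul_mem _ (hgen _ (Or.inl (Or.inr rfl))) c
  have h3 : ∀ i, 2 ≤ i → i ≤ e - 1 →
      (q + 1) * symMult e q + (q + i) * d ∈ symSemigroup e q d :=
    fun i hi hi' => hgen _ (Or.inr ⟨i, hi, hi', rfl⟩)
  apply Set.Subset.antisymm
  · rintro s ⟨a, b, hb, h, rfl⟩
    rcases h with ⟨-, h⟩ | ⟨-, hb2, ha, hab⟩
    · obtain ⟨c, rfl⟩ := Nat.exists_eq_add_of_le h
      have := add_mem (h2 b) (h1 c)
      refine (congrArg (· ∈ symSemigroup e q d) ?_).mpr this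
      ring
    · -- one generator `(q+1) m + (q+i) d`, `j` generators `m + d`, the rest `m`
      obtain ⟨i, j, c, hi, hi', rfl, rfl⟩ : ∃ i j c, 2 ≤ i ∧ i ≤ e - 1 ∧ b = q + i + j ∧
          a = q + 1 + j + c := by
        by_cases hbe : b ≤ q + (e - 1)
        · exact ⟨b - q, 0, a - (q + 1), by omega, by omega, by omega, by omega⟩
        · exact ⟨e - 1, b - (q + (e - 1)), a - (q + 1) - (b - (q + (e - 1))), by omega, by omega,
            by omega, by omega⟩
      have := add_mem (h3 i hi hi') (add_mem (h2 j) (h1 c))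
      refine (congrArg (· ∈ symSemigroup e q d) ?_).mpr this
      ring
  · intro s hs
    induction hs using AddSubmonoid.closure_induction with
    | mem x hx =>
      rcases hx with (rfl | rfl) | ⟨i, hi, hi', rfl⟩
      · exact ⟨1, 0, by unfold symMult; omega, Or.inl (by omega), by ring⟩
      · exact ⟨1, 1, by unfold symMult; omega, Or.inl (by omega), by ring⟩
      · exact ⟨q + 1, q + i, by unfold symMult; omega, Or.inr (by omega), rfl⟩
    | zero => exact ⟨0, 0, symMult_pos, Or.inl (by omega), by ring⟩
    | add x y _ _ hx hy => exact add_mem_symFiltration hx hy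

theorem mem_symFiltration_one_iff {s : ℕ} :
    s ∈ symFiltration e q d 1 ↔ s ∈ symFiltration e q d 0 ∧ s ≠ 0 := by
  constructor
  · intro h
    refine ⟨symFiltration_anti zero_le_one h, ?_⟩
    obtain ⟨a, b, -, h, rfl⟩ := h
    have ha : 0 < a := by unfold OrderGe at h; omega
    have := Nat.mul_pos ha (symMult_pos (e := e) (q := q))
    omega
  · rintro ⟨⟨a, b, hb, h, rfl⟩, h0⟩
    refine ⟨a, b, hb, ?_, rfl⟩
    have : a ≠ 0 ∨ b ≠ 0 := by
      by_contra! hab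
      exact h0 (by simp [hab])
    unfold OrderGe at *
    omega

/-- Every large integer lies in the semigroup. -/
theorem mem_symFiltration_zero_of_le (hmd : Nat.gcd (symMult e q) d = 1) {s : ℕ}
    (hs : symMult e q * (symMult e q + d) ≤ s) : s ∈ symFiltration e q d 0 := by
  have hm : 0 < symMult e q := symMult_pos
  obtain ⟨c, hc⟩ : ∃ c, c * d ≡ s [MOD symMult e q] := by
    have h : Nat.gcd d (symMult e q) = 1 := by rw [Nat.gcd_comm]; exact hmd
    obtain ⟨c, hc⟩ := Nat.exists_mul_mod_eq_of_coprime s h hm.ne'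
    exact ⟨c, by rw [Nat.ModEq, mul_comm]; exact hc.2⟩
  have hc' : (c % symMult e q) * d ≡ s [MOD symMult e q] :=
    ((Nat.mod_modEq c _).mul_right d).trans hc
  have hb := Nat.mod_lt c hm
  generalize c % symMult e q = b at hc' hb
  have hbs : b * d + b * symMult e q ≤ s := by
    refine le_trans ?_ hs
    rw [← mul_add, add_comm d]
    exact Nat.mul_le_mul_right _ hb.le
  obtain ⟨a, ha⟩ := (Nat.modEq_iff_dvd' (by omega)).1 hc'
  have hs : s = a * symMult e q + b * d := by rw [mul_comm a, ← ha]; omega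
  refine ⟨a, b, hb, Or.inl ⟨Nat.zero_le _, ?_⟩, hs⟩
  exact Nat.le_of_mul_le_mul_right (by omega : b * symMult e q ≤ a * symMult e q) hm

end Semigroup

/-! ### Powers of the maximal ideal -/

section Powers

variable {k : Type*} [Field k] {e q d : ℕ}

/-- The inclusion `k[[Γ]] ⊆ k[[t]]`. -/
noncomputable def symVal : SymRing k e q d →+* PowerSeries k :=
  (semigroupRing k (symSemigroup e q d)).val.toRingHom

/-- The coefficient of `t^s`. -/
noncomputable def symCoeff (s : ℕ) : SymRing k e q d →+ k :=
  (PowerSeries.coeff (R := k) s).toAddMonoidHom.comp (symVal (k := k)).toAddMonoidHom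

/-- The constants of `k[[Γ]]`. -/
noncomputable def symConst : k →+* SymRing k e q d :=
  algebraMap k (semigroupRing k (symSemigroup e q d))

theorem symCoeff_apply (s : ℕ) (f : SymRing k e q d) :
    symCoeff s f = PowerSeries.coeff s (symVal f) := rfl

theorem symVal_injective : Function.Injective (symVal : SymRing k e q d →+* PowerSeries k) :=
  Subtype.val_injective

theorem symCoeff_ext {f g : SymRing k e q d} (h : ∀ s, symCoeff s f = symCoeff s g) : f = g :=
  symVal_injective (PowerSeries.ext h)

theorem symVal_const (c : k) : symVal (symConst c : SymRing k e q d) = PowerSeries.C c := rfl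

theorem symVal_T : symVal (symT k e q d) = PowerSeries.X ^ symMult e q := rfl

theorem symCoeff_eq_zero {s : ℕ} (hs : s ∉ symSemigroup e q d) (f : SymRing k e q d) :
    symCoeff s f = 0 := f.2 s hs

/-- A power series with exponents in the semigroup, as an element of `k[[Γ]]`. -/
noncomputable def symMk (f : PowerSeries k)
    (hf : ∀ s, s ∉ symSemigroup e q d → PowerSeries.coeff s f = 0) : SymRing k e q d :=
  (⟨f, hf⟩ : semigroupRing k (symSemigroup e q d))

theorem symVal_mk (f : PowerSeries k)
    (hf : ∀ s, s ∉ symSemigroup e q d → PowerSeries.coeff s f = 0) :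
    symVal (symMk f hf) = f := rfl

open Classical in
/-- The element `c t^s` of `k[[Γ]]`; it is `0` when `s ∉ Γ`. -/
noncomputable def symMonomial (c : k) (s : ℕ) : SymRing k e q d :=
  if hs : s ∈ symSemigroup e q d then
    symMk (PowerSeries.C c * PowerSeries.X ^ s) fun n hn => by
      rw [PowerSeries.coeff_C_mul, PowerSeries.coeff_X_pow,
        if_neg (fun h : n = s => hn (h ▸ hs)), mul_zero]
  else 0

theorem symVal_monomial (c : k) {s : ℕ} (hs : s ∈ symSemigroup e q d) :
    symVal (symMonomial c s : SymRing k e q d) = PowerSeries.C c * PowerSeries.X ^ s := by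
  rw [symMonomial, dif_pos hs, symVal_mk]

theorem symCoeff_monomial (c : k) {s : ℕ} (hs : s ∈ symSemigroup e q d) (s' : ℕ) :
    symCoeff s' (symMonomial c s : SymRing k e q d) = if s' = s then c else 0 := by
  rw [symCoeff_apply, symVal_monomial c hs, PowerSeries.coeff_C_mul, PowerSeries.coeff_X_pow,
    mul_ite, mul_one, mul_zero]

theorem mem_maximalIdeal_iff {f : SymRing k e q d} :
    f ∈ IsLocalRing.maximalIdeal (SymRing k e q d) ↔ symCoeff 0 f = 0 := by
  rw [IsLocalRing.mem_maximalIdeal, mem_nonunits_iff]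
  refine (not_congr (semigroupRing.isUnit_iff (Γ := symSemigroup e q d) f)).trans ?_
  rw [not_not, symCoeff_apply, PowerSeries.coeff_zero_eq_constantCoeff_apply]
  rfl

theorem symMonomial_mem_pow (he : 4 ≤ e) (c : k) (n : ℕ) {s : ℕ}
    (hs : s ∈ symFiltration e q d n) :
    symMonomial c s ∈ IsLocalRing.maximalIdeal (SymRing k e q d) ^ n := by
  induction n generalizing s c with
  | zero => simp
  | succ n ih =>
    obtain ⟨u, hu, v, hv, rfl⟩ := exists_add_of_mem_symFiltration he hs
    have hmem : ∀ {j x}, x ∈ symFiltration e q d j → x ∈ symSemigroup e q d := fun {j x} hx => by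
      have := symFiltration_anti (Nat.zero_le _) hx
      rwa [symFiltration_zero he] at this
    have h : (symMonomial c (u + v) : SymRing k e q d) = symMonomial c u * symMonomial 1 v := by
      apply symVal_injective
      rw [map_mul, symVal_monomial _ (hmem hs), symVal_monomial _ (hmem hu),
        symVal_monomial _ (hmem hv), map_one, pow_add]
      ring
    rw [h, pow_succ']
    refine Ideal.mul_mem_mul ?_ (ih 1 hv)
    rw [mem_maximalIdeal_iff, symCoeff_monomial _ (hmem hu),
      if_neg (mem_symFiltration_one_iff.1 hu).2.symm]

/-- The power `𝔪ⁿ` consists of the power series whose exponents are sums of at least `n`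
generators. For the inclusion from right to left, only finitely many monomials are not covered by
a multiple of `(t^m)ⁿ`. -/
theorem mem_maximalIdeal_pow_iff (he : 4 ≤ e) (hmd : Nat.gcd (symMult e q) d = 1) (n : ℕ)
    {f : SymRing k e q d} :
    f ∈ IsLocalRing.maximalIdeal (SymRing k e q d) ^ n ↔
      ∀ s, s ∉ symFiltration e q d n → symCoeff s f = 0 := by
  constructor
  · intro hf
    induction n generalizing f with
    | zero =>
      intro s hs
      rw [symFiltration_zero he] at hs
      exact symCoeff_eq_zero hs f
    | succ n ih =>
      rw [pow_succ] at hf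
      induction hf using Submodule.mul_induction_on' with
      | mem_mul_mem x hx y hy =>
        intro s hs
        rw [symCoeff_apply, map_mul, PowerSeries.coeff_mul]
        refine Finset.sum_eq_zero fun p hp => ?_
        rw [← symCoeff_apply, ← symCoeff_apply]
        by_cases h1 : p.1 ∈ symFiltration e q d n
        · refine mul_eq_zero_of_right _ ?_
          by_cases h0 : p.2 = 0
          · rw [h0]; exact mem_maximalIdeal_iff.1 hy
          · refine symCoeff_eq_zero (fun h2 => hs ?_) y
            rw [← Finset.HasAntidiagonal.mem_antidiagonal.1 hp]
            refine add_mem_symFiltration h1 (mem_symFiltration_one_iff.2 ⟨?_, h0⟩)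
            rw [symFiltration_zero he]; exact h2
        · rw [ih hx _ h1, zero_mul]
      | add x _ y _ hx hy => intro s hs; rw [map_add, hx s hs, hy s hs, add_zero]
  · intro hf
    set m := symMult e q with hm
    set N := n * m + m * (m + d) with hN
    have hTn : symT k e q d ^ n ∈ IsLocalRing.maximalIdeal (SymRing k e q d) ^ n :=
      Ideal.pow_mem_pow (symIdeal_le k e q d (Ideal.mem_span_singleton_self _)) n
    -- the part of exponents `≥ N`, divided by `(t^m)ⁿ`
    let g : SymRing k e q d := symMk
      (PowerSeries.mk fun s => if s < m * (m + d) then 0 else symCoeff (s + n * m) f)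
      (fun s hs => by
        rw [PowerSeries.coeff_mk, if_pos]
        by_contra! h
        apply hs
        have := mem_symFiltration_zero_of_le hmd h
        rwa [symFiltration_zero he] at this)
    have key : f = symT k e q d ^ n * g +
        ∑ s ∈ Finset.range N, symMonomial (symCoeff s f) s := by
      apply symCoeff_ext
      intro s
      have h1 : symCoeff s (symT k e q d ^ n * g) = if N ≤ s then symCoeff s f else 0 := by
        rw [symCoeff_apply, map_mul, map_pow, symVal_T, ← pow_mul, mul_comm m n,
          PowerSeries.coeff_X_pow_mul', symVal_mk, PowerSeries.coeff_mk]
        split_ifs with h1 h2 h3 h3 h3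
        · omega
        · rfl
        · rw [Nat.sub_add_cancel h1]
        · omega
        · omega
        · rfl
      have h2 : symCoeff s (∑ s ∈ Finset.range N,
          (symMonomial (symCoeff s f) s : SymRing k e q d)) = if s < N then symCoeff s f else 0 := by
        have h3 : ∀ i, symCoeff s (symMonomial (symCoeff i f) i : SymRing k e q d) =
            if s = i then symCoeff i f else 0 := by
          intro i
          by_cases hi : i ∈ symSemigroup e q d
          · exact symCoeff_monomial _ hi _
          · rw [symCoeff_eq_zero hi, ite_self, symMonomial, dif_neg hi, map_zero]
        rw [map_sum, Finset.sum_congr rfl fun i _ => h3 i, Finset.sum_ite_eq]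
        simp only [Finset.mem_range]
      rw [map_add, h1, h2]
      split_ifs <;> first | omega | simp
    rw [key]
    refine add_mem (Ideal.mul_mem_right _ _ hTn) (sum_mem fun s _ => ?_)
    by_cases hs : s ∈ symFiltration e q d n
    · exact symMonomial_mem_pow he _ n hs
    · rw [hf s hs]
      have : (symMonomial 0 s : SymRing k e q d) = 0 := by
        rw [symMonomial]
        split_ifs
        · apply symVal_injective
          rw [symVal_mk, map_zero, map_zero, zero_mul]
        · rfl
      rw [this]
      exact zero_mem _

end Powers

/-! ### The fiber cone of `(t^m)` -/

section Fiber

variable {k : Type*} [Field k] {e q d : ℕ}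

theorem symT_pow_mem (n : ℕ) : symT k e q d ^ n ∈ symIdeal k e q d ^ n :=
  Ideal.pow_mem_pow (Ideal.mem_span_singleton_self _) n

theorem mem_symIdeal_pow {n : ℕ} {f : SymRing k e q d} :
    f ∈ symIdeal k e q d ^ n ↔ ∃ g, f = symT k e q d ^ n * g := by
  rw [symIdeal, Ideal.span_singleton_pow, Ideal.mem_span_singleton]; rfl

theorem symVal_T_pow (n : ℕ) :
    symVal (symT k e q d ^ n) = PowerSeries.X ^ (n * symMult e q) := by
  rw [map_pow, symVal_T, ← pow_mul, mul_comm]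

theorem symCoeff_T_pow_mul (n : ℕ) (g : SymRing k e q d) :
    symCoeff (n * symMult e q) (symT k e q d ^ n * g) = symCoeff 0 g := by
  rw [symCoeff_apply, map_mul, symVal_T_pow, PowerSeries.coeff_X_pow_mul', if_pos le_rfl,
    Nat.sub_self, symCoeff_apply]

/-- The coefficient of the class of `t^{jm}` in an element of the fiber cone. -/
noncomputable def fiberCoeff (j : ℕ) : FiberCone (symIdeal k e q d) →+ k :=
  FiberCone.functional (symIdeal k e q d) j (symCoeff (j * symMult e q)) fun x hx => by
    induction hx using Submodule.mul_induction_on' with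
    | mem_mul_mem y hy z hz =>
      obtain ⟨g, rfl⟩ := mem_symIdeal_pow.1 hz
      rw [mul_left_comm, symCoeff_T_pow_mul, ← mem_maximalIdeal_iff]
      exact Ideal.mul_mem_right _ _ hy
    | add y _ z _ hy hz => rw [map_add, hy, hz, add_zero]

/-- The class `(t^m)*` of `t^m`. -/
noncomputable def fiberT : FiberCone (symIdeal k e q d) :=
  FiberCone.degreeOne (symIdeal k e q d) (symT k e q d) (Ideal.mem_span_singleton_self _)

/-- The ring homomorphism `k[X] → F(I)` that sends `X` to `(t^m)*`. -/
noncomputable def polyToFiber : k[X] →+* FiberCone (symIdeal k e q d) :=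
  Polynomial.eval₂RingHom ((algebraMap (SymRing k e q d) _).comp symConst) fiberT

theorem polyToFiber_X : polyToFiber (X : k[X]) = (fiberT : FiberCone (symIdeal k e q d)) :=
  Polynomial.eval₂_X _ _

theorem fiberT_pow (j : ℕ) : (fiberT : FiberCone (symIdeal k e q d)) ^ j =
    FiberCone.cls (symIdeal k e q d) j (symT k e q d ^ j) (symT_pow_mem j) :=
  FiberCone.degreeOne_pow _ _ _ j

theorem polyToFiber_monomial (j : ℕ) (c : k) :
    polyToFiber (Polynomial.monomial j c) = FiberCone.cls (symIdeal k e q d) j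
      (symConst c * symT k e q d ^ j) (Ideal.mul_mem_left _ _ (symT_pow_mem j)) := by
  refine (Polynomial.eval₂_monomial _ _).trans ?_
  rw [RingHom.comp_apply, FiberCone.algebraMap_eq_cls, fiberT_pow, FiberCone.cls_mul]
  exact FiberCone.cls_congr (zero_add j) rfl

theorem fiberCoeff_polyToFiber (j : ℕ) (p : k[X]) :
    fiberCoeff j (polyToFiber p : FiberCone (symIdeal k e q d)) = p.coeff j := by
  induction p using Polynomial.induction_on' with
  | add p r hp hr => rw [map_add, map_add, hp, hr, Polynomial.coeff_add]
  | monomial i c =>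
    rw [polyToFiber_monomial, fiberCoeff, FiberCone.functional_cls, Polynomial.coeff_monomial]
    refine if_ctx_congr Iff.rfl (fun h => ?_) fun _ => rfl
    rw [h, mul_comm (symConst c), symCoeff_T_pow_mul, symCoeff_apply, symVal_const, PowerSeries.coeff_C,
      if_pos rfl]

theorem polyToFiber_bijective :
    Function.Bijective (polyToFiber : k[X] →+* FiberCone (symIdeal k e q d)) := by
  refine ⟨fun p r h => Polynomial.ext fun j => ?_, fun x => ?_⟩
  · rw [← fiberCoeff_polyToFiber (e := e) (q := q) (d := d), h, fiberCoeff_polyToFiber]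
  · obtain ⟨f, rfl⟩ := FiberCone.mk_surjective _ x
    rw [FiberCone.mk_eq_sum_cls]
    refine (polyToFiber : k[X] →+* FiberCone (symIdeal k e q d)).range.sum_mem fun n _ => ?_
    obtain ⟨g, hg⟩ := mem_symIdeal_pow.1 (f.2 n)
    have hc : symConst (symCoeff 0 g) * symT k e q d ^ n ∈ symIdeal k e q d ^ n :=
      Ideal.mul_mem_left _ _ (symT_pow_mem n)
    have hr : (g - symConst (symCoeff 0 g)) * symT k e q d ^ n ∈
        IsLocalRing.maximalIdeal (SymRing k e q d) * symIdeal k e q d ^ n := by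
      refine Ideal.mul_mem_mul ?_ (symT_pow_mem n)
      rw [mem_maximalIdeal_iff, map_sub, sub_eq_zero, symCoeff_apply 0 (symConst _), symVal_const,
        PowerSeries.coeff_C, if_pos rfl]
    have hr' : (g - symConst (symCoeff 0 g)) * symT k e q d ^ n ∈ symIdeal k e q d ^ n :=
      Ideal.mul_mem_left _ _ (symT_pow_mem n)
    have h0 := (FiberCone.cls_eq_zero_iff hr').2 hr
    have hsum := FiberCone.cls_add hc hr'
    rw [h0, add_zero, ← polyToFiber_monomial] at hsum
    refine ⟨Polynomial.monomial n (symCoeff 0 g), hsum.symm.trans (FiberCone.cls_congr rfl ?_)⟩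
    rw [hg]; ring

/-- The fiber cone of `(t^m)` is a polynomial ring in `(t^m)*`. -/
noncomputable def polyEquivFiber : k[X] ≃+* FiberCone (symIdeal k e q d) :=
  RingEquiv.ofBijective polyToFiber polyToFiber_bijective

theorem fiberCoeff_polyEquivFiber (j : ℕ) (p : k[X]) :
    fiberCoeff j (polyEquivFiber p : FiberCone (symIdeal k e q d)) = p.coeff j :=
  fiberCoeff_polyToFiber j p

theorem polyEquivFiber_monomial (j : ℕ) (c : k) :
    polyEquivFiber (Polynomial.monomial j c) = FiberCone.cls (symIdeal k e q d) j
      (symConst c * symT k e q d ^ j) (Ideal.mul_mem_left _ _ (symT_pow_mem j)) :=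
  polyToFiber_monomial j c

theorem polyEquivFiber_mem_piece_iff {n : ℕ} {p : k[X]} :
    polyEquivFiber p ∈ FiberCone.piece (symIdeal k e q d) n ↔ ∀ j, j ≠ n → p.coeff j = 0 := by
  rw [FiberCone.mem_piece_iff]
  constructor
  · rintro ⟨r, hr, h⟩ j hj
    rw [← fiberCoeff_polyEquivFiber (e := e) (q := q) (d := d), h, fiberCoeff,
      FiberCone.functional_cls, if_neg hj.symm]
  · intro h
    have : p = Polynomial.monomial n (p.coeff n) := by
      ext j
      rw [Polynomial.coeff_monomial]
      split_ifs with hj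
      · rw [hj]
      · exact h j (Ne.symm hj)
    rw [this]
    exact ⟨_, _, polyEquivFiber_monomial _ _⟩

theorem polyEquivFiber_mem_shiftPiece_iff {b n : ℕ} {p : k[X]} :
    polyEquivFiber p ∈ shiftPiece (FiberCone.piece (symIdeal k e q d)) b n ↔
      ∀ j, b + j ≠ n → p.coeff j = 0 := by
  unfold shiftPiece
  split_ifs with h
  · rw [polyEquivFiber_mem_piece_iff]
    exact forall_congr' fun j => imp_congr_left (by omega)
  · rw [Submodule.mem_bot, map_eq_zero_iff _ (RingEquiv.injective _)]
    refine ⟨fun h0 j _ => by rw [h0, Polynomial.coeff_zero], fun h0 => Polynomial.ext fun j => ?_⟩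
    rw [h0 j (by omega), Polynomial.coeff_zero]

theorem polyEquivFiber_mem_torsion_iff {c : ℕ} {p : k[X]} :
    polyEquivFiber p ∈ symTorsion k e q d c ↔ ∀ j < c, p.coeff j = 0 := by
  rw [← Polynomial.X_pow_dvd_iff, symTorsion, Ideal.mem_span_singleton,
    ← map_dvd_iff (polyEquivFiber (k := k) (e := e) (q := q) (d := d)), map_pow]
  exact iff_of_eq (congrArg (fun z => z ^ c ∣ polyEquivFiber p) polyToFiber_X.symm)

/-- The class of a polynomial `p` in `F(I)/((t^m)*)^c (-b)` is homogeneous of degree `n` iff the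
coefficients of `p` below `c` and outside the degree `n - b` vanish. -/
theorem polyEquivFiber_mem_shiftPiece_quotPiece_iff {b c n : ℕ} {p : k[X]} :
    Ideal.Quotient.mk (symTorsion k e q d c) (polyEquivFiber p) ∈
        shiftPiece (FiberCone.quotPiece (symTorsion k e q d c)) b n ↔
      ∀ j < c, b + j ≠ n → p.coeff j = 0 := by
  unfold shiftPiece
  split_ifs with h
  · constructor
    · rintro ⟨x, hx, hxp⟩ j hj hjn
      obtain ⟨r, rfl⟩ := polyEquivFiber.surjective x
      have hxp' : Ideal.Quotient.mk (symTorsion k e q d c) (polyEquivFiber r) =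
        Ideal.Quotient.mk _ (polyEquivFiber p) := hxp
      rw [Ideal.Quotient.eq, ← map_sub, polyEquivFiber_mem_torsion_iff] at hxp'
      have h1 := hxp' j hj
      rw [Polynomial.coeff_sub, polyEquivFiber_mem_piece_iff.1 hx j (by omega), zero_sub,
        neg_eq_zero] at h1
      exact h1
    · intro hp
      refine ⟨polyEquivFiber (Polynomial.monomial (n - b) (p.coeff (n - b))),
        polyEquivFiber_mem_piece_iff.2 fun j hj => Polynomial.coeff_monomial_of_ne _ hj, ?_⟩
      refine Ideal.Quotient.eq.2 ?_
      rw [← map_sub, polyEquivFiber_mem_torsion_iff]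
      intro j hj
      rw [Polynomial.coeff_sub, Polynomial.coeff_monomial]
      split_ifs with h1
      · rw [h1, sub_self]
      · rw [hp j hj (by omega), sub_zero]
  · rw [Submodule.mem_bot, Ideal.Quotient.eq_zero_iff_mem, polyEquivFiber_mem_torsion_iff]
    exact forall_congr' fun j => forall_congr' fun hj =>
      ⟨fun h0 _ => h0, fun h0 => h0 (by omega)⟩

end Fiber

/-! ### The tangent cone -/

section Tangent

variable {k : Type*} [Field k] {e q d : ℕ}

/-- The coefficient of the class of `t^{am+bd}` in an element of the tangent cone. -/
noncomputable def tangentCoeff (he : 4 ≤ e) (hmd : Nat.gcd (symMult e q) d = 1) (a : ℕ)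
    (b : Fin (symMult e q)) : TangentCone (SymRing k e q d) →+ k :=
  FiberCone.functional (IsLocalRing.maximalIdeal (SymRing k e q d)) (symOrder q a b)
    (symCoeff (a * symMult e q + b * d)) fun x hx => by
      rw [← pow_succ', mem_maximalIdeal_pow_iff he hmd] at hx
      apply hx
      rw [mem_symFiltration_iff hmd b.2]
      exact not_orderGe_symOrder_add_one _ _

/-- The class in `𝔪ⁿ / 𝔪ⁿ⁺¹` of an element of `𝔪ⁿ`. -/
noncomputable def tangentCls (n : ℕ) (r : SymRing k e q d)
    (hr : r ∈ IsLocalRing.maximalIdeal (SymRing k e q d) ^ n) : TangentCone (SymRing k e q d) :=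
  FiberCone.cls _ n r hr

variable (he : 4 ≤ e) (hmd : Nat.gcd (symMult e q) d = 1)

theorem tangentCoeff_cls (a : ℕ) (b : Fin (symMult e q)) (n : ℕ) (r : SymRing k e q d)
    (hr : r ∈ IsLocalRing.maximalIdeal (SymRing k e q d) ^ n) :
    tangentCoeff he hmd a b (tangentCls n r hr) =
      if n = symOrder q a b then symCoeff (a * symMult e q + b * d) r else 0 :=
  FiberCone.functional_cls _ _ _ _ n r hr

/-- The quotient map `R[𝔪t] → G_𝔪(R)`. -/
noncomputable def tangentMk (f : reesAlgebra (IsLocalRing.maximalIdeal (SymRing k e q d))) :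
    TangentCone (SymRing k e q d) :=
  FiberCone.mk _ f

theorem tangentMk_surjective (x : TangentCone (SymRing k e q d)) : ∃ f, tangentMk f = x :=
  FiberCone.mk_surjective _ x

theorem tangentCoeff_mk (a : ℕ) (b : Fin (symMult e q))
    (f : reesAlgebra (IsLocalRing.maximalIdeal (SymRing k e q d))) :
    tangentCoeff he hmd a b (tangentMk f) =
      symCoeff (a * symMult e q + b * d)
        ((f : (SymRing k e q d)[X]).coeff (symOrder q a b)) :=
  rfl

/-- The coefficients determine the elements of the tangent cone. -/
theorem tangent_eq_zero {x : TangentCone (SymRing k e q d)}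
    (h : ∀ a b, tangentCoeff he hmd a b x = 0) : x = 0 := by
  obtain ⟨f, rfl⟩ := tangentMk_surjective x
  refine (FiberCone.mk_eq_zero_iff _ f).2 fun n => ?_
  rw [← pow_succ', mem_maximalIdeal_pow_iff he hmd]
  intro s hs
  by_cases hs0 : s ∈ symFiltration e q d n
  · obtain ⟨a, b, hb, hab, rfl⟩ := hs0
    rw [mem_symFiltration_iff hmd hb] at hs
    have h1 := h a ⟨b, hb⟩
    rw [tangentCoeff_mk] at h1
    rwa [symOrder_eq_of_orderGe hab hs] at h1
  · exact (mem_maximalIdeal_pow_iff he hmd n).1 (f.2 n) s hs0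

theorem tangentCoeff_eventually_zero (x : TangentCone (SymRing k e q d)) :
    ∃ N, ∀ a b, N ≤ a → tangentCoeff he hmd a b x = 0 := by
  obtain ⟨f, rfl⟩ := tangentMk_surjective x
  refine ⟨(f : (SymRing k e q d)[X]).natDegree + q + 1, fun a b ha => ?_⟩
  rw [tangentCoeff_mk, Polynomial.coeff_eq_zero_of_natDegree_lt, map_zero]
  unfold symOrder
  split_ifs <;> omega

theorem tangentCoeff_eq_zero_of_not_orderGe {a : ℕ} {b : Fin (symMult e q)}
    (h : ¬ OrderGe e q 0 a b) (x : TangentCone (SymRing k e q d)) :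
    tangentCoeff he hmd a b x = 0 := by
  obtain ⟨f, rfl⟩ := tangentMk_surjective x
  rw [tangentCoeff_mk]
  refine symCoeff_eq_zero (fun h1 => h ?_) _
  rw [← mem_symFiltration_iff hmd b.2, symFiltration_zero he]
  exact h1

theorem mem_tangentPiece_iff {n : ℕ} {x : TangentCone (SymRing k e q d)} :
    x ∈ TangentCone.piece (SymRing k e q d) n ↔
      ∀ a (b : Fin (symMult e q)), symOrder q a b ≠ n → tangentCoeff he hmd a b x = 0 := by
  constructor
  · intro hx a b hab
    obtain ⟨r, hr, rfl⟩ := FiberCone.mem_piece_iff.1 hx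
    exact (tangentCoeff_cls he hmd a b n r hr).trans (if_neg hab.symm)
  · intro hx
    obtain ⟨f, rfl⟩ := tangentMk_surjective x
    suffices h : tangentMk f - tangentCls n _ (f.2 n) = 0 from
      FiberCone.mem_piece_iff.2 ⟨_, f.2 n, sub_eq_zero.1 h⟩
    refine tangent_eq_zero he hmd fun a b => ?_
    rw [map_sub, tangentCoeff_cls]
    split_ifs with h
    · rw [tangentCoeff_mk, ← h, sub_self]
    · rw [hx a b (Ne.symm h), sub_zero]

theorem fiberCls_smul_tangentCls {j n : ℕ} {r r' : SymRing k e q d}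
    (hr : r ∈ symIdeal k e q d ^ j)
    (hr' : r' ∈ IsLocalRing.maximalIdeal (SymRing k e q d) ^ n) :
    FiberCone.cls (symIdeal k e q d) j r hr • tangentCls n r' hr' =
      tangentCls (j + n) (r * r') (by
        rw [pow_add]
        exact Ideal.mul_mem_mul (Ideal.pow_right_mono (symIdeal_le k e q d) j hr) hr') :=
  -- `F(I) → G_𝔪` sends the class of `r` to the class of `r`, definitionally
  FiberCone.cls_mul (Ideal.pow_right_mono (symIdeal_le k e q d) j hr) hr'

/-- The class of `t^{am+bd}` in `𝔪ⁿ / 𝔪ⁿ⁺¹`. -/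
noncomputable def tangentGen (he : 4 ≤ e) (n a : ℕ) (b : Fin (symMult e q))
    (h : OrderGe e q n a b) : TangentCone (SymRing k e q d) :=
  tangentCls n (symMonomial 1 (a * symMult e q + b * d))
    (symMonomial_mem_pow he 1 n ⟨a, b, b.2, h, rfl⟩)

/-- The action of `F(I) ≅ k[X]` on the class of a monomial, in coordinates: multiplication by
`(t^m)*` raises `a` and the degree by one, and gives zero when the order jumps. -/
theorem tangentCoeff_smul_gen (n a₀ : ℕ) (b₀ : Fin (symMult e q)) (h : OrderGe e q n a₀ b₀)
    (p : k[X]) (a : ℕ) (b : Fin (symMult e q)) :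
    tangentCoeff he hmd a b ((polyEquivFiber p : FiberCone (symIdeal k e q d)) •
        tangentGen he n a₀ b₀ h) =
      if b = b₀ ∧ a₀ ≤ a ∧ n + (a - a₀) = symOrder q a b then p.coeff (a - a₀) else 0 := by
  have hmem : a₀ * symMult e q + b₀ * d ∈ symSemigroup e q d := by
    rw [← SetLike.mem_coe, ← symFiltration_zero he]
    exact ⟨a₀, b₀, b₀.2, h.mono (Nat.zero_le _), rfl⟩
  induction p using Polynomial.induction_on' with
  | add p r hp hr =>
    rw [map_add, add_smul, map_add, hp, hr, Polynomial.coeff_add]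
    split_ifs <;> simp
  | monomial j c =>
    rw [polyEquivFiber_monomial, tangentGen, fiberCls_smul_tangentCls, tangentCoeff_cls,
      Polynomial.coeff_monomial]
    have hc : symCoeff (a * symMult e q + b * d)
        (symConst c * symT k e q d ^ j * symMonomial 1 (a₀ * symMult e q + b₀ * d)) =
        if a * symMult e q + b * d = (a₀ + j) * symMult e q + b₀ * d then c else 0 := by
      rw [symCoeff_apply, map_mul symVal, map_mul symVal, symVal_const, symVal_T_pow, symVal_monomial _ hmem,
        map_one, one_mul, mul_assoc, ← pow_add, PowerSeries.coeff_C_mul, PowerSeries.coeff_X_pow,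
        mul_ite, mul_one, mul_zero]
      rw [show j * symMult e q + (a₀ * symMult e q + b₀ * d) =
        (a₀ + j) * symMult e q + b₀ * d by ring]
    rw [hc, ← ite_and, ← ite_and]
    refine if_congr ?_ rfl rfl
    constructor
    · rintro ⟨h1, h2⟩
      obtain ⟨h3, h4⟩ := symRepr_unique hmd b.2 b₀.2 h2
      exact ⟨⟨Fin.ext h4, by omega, by omega⟩, by omega⟩
    · rintro ⟨⟨rfl, h2, h3⟩, h4⟩
      refine ⟨by omega, ?_⟩
      rw [h4, Nat.add_sub_cancel' h2]

end Tangent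

/-! ### The decomposition of the tangent cone -/

section Decomposition

variable {k : Type*} [Field k] {e q d : ℕ}

/-- The length of the torsion summand attached to the residue class of `b d` modulo `m`: the
number of `a < b` for which `a m + b d` lies in the semigroup. -/
def torsionLength (e q b : ℕ) : ℕ := min (b - (q + 1)) (e - 2)

theorem orderGe_self (b : ℕ) : OrderGe e q b b b := Or.inl ⟨le_rfl, le_rfl⟩

/-- The generator of the free summand attached to the residue class of `b d`: the class of
`t^{b(m+d)}` in degree `b`. -/
noncomputable def freeGen (he : 4 ≤ e) (b : Fin (symMult e q)) : TangentCone (SymRing k e q d) :=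
  tangentGen he b b b (orderGe_self b)

open Classical in
/-- The generator of the torsion summand attached to the residue class of `b d`: the class of the
smallest element of the semigroup in this residue class, or `0` if the torsion summand is trivial. -/
noncomputable def torsionGen (he : 4 ≤ e) (b : Fin (symMult e q)) :
    TangentCone (SymRing k e q d) :=
  if h : q + 2 ≤ (b : ℕ) then
    tangentGen he (b - torsionLength e q b - q) (b - torsionLength e q b) b (by
      unfold OrderGe torsionLength; omega)
  else 0

variable (he : 4 ≤ e) (hmd : Nat.gcd (symMult e q) d = 1)

theorem tangentCoeff_smul_freeGen (b : Fin (symMult e q)) (p : k[X]) (a : ℕ)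
    (b' : Fin (symMult e q)) :
    tangentCoeff he hmd a b' ((polyEquivFiber p : FiberCone (symIdeal k e q d)) • freeGen he b) =
      if b' = b ∧ (b : ℕ) ≤ a then p.coeff (a - b) else 0 := by
  rw [freeGen, tangentCoeff_smul_gen]
  refine if_congr (and_congr_right ?_) rfl rfl
  rintro rfl
  refine ⟨And.left, fun h => ⟨h, ?_⟩⟩
  rw [symOrder, if_pos h]
  omega

theorem tangentCoeff_smul_torsionGen (hq : 1 ≤ q) (b : Fin (symMult e q)) (p : k[X]) (a : ℕ)
    (b' : Fin (symMult e q)) :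
    tangentCoeff he hmd a b'
        ((polyEquivFiber p : FiberCone (symIdeal k e q d)) • torsionGen he b) =
      if b' = b ∧ b - torsionLength e q b ≤ a ∧ a < b then
        p.coeff (a - (b - torsionLength e q b)) else 0 := by
  rw [torsionGen]
  split_ifs with hb h h
  · rw [tangentCoeff_smul_gen, if_pos]
    obtain ⟨rfl, h1, h2⟩ := h
    refine ⟨rfl, h1, ?_⟩
    rw [symOrder, if_neg (by omega)]
    unfold torsionLength at *
    omega
  · rw [tangentCoeff_smul_gen, if_neg]
    rintro ⟨rfl, h1, h2⟩
    refine h ⟨rfl, h1, ?_⟩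
    unfold symOrder torsionLength at *
    split_ifs at h2 <;> omega
  · unfold torsionLength at h
    omega
  · rw [smul_zero, map_zero]

variable (hq : 1 ≤ q)

/-- The map from the torsion summand of length `c` to the tangent cone. The length is a separate
variable, so that it may be given in a form that is only propositionally equal to
`torsionLength e q b`. -/
noncomputable def torsionMap (b : Fin (symMult e q)) (c : ℕ) (hc : c = torsionLength e q b) :
    (FiberCone (symIdeal k e q d) ⧸ symTorsion k e q d c) →ₗ[FiberCone (symIdeal k e q d)]
      TangentCone (SymRing k e q d) :=
  Submodule.liftQ (symTorsion k e q d c)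
    (LinearMap.toSpanSingleton (FiberCone (symIdeal k e q d)) _ (torsionGen he b)) fun x hx => by
      obtain ⟨p, rfl⟩ := polyEquivFiber.surjective x
      rw [polyEquivFiber_mem_torsion_iff] at hx
      rw [LinearMap.mem_ker, LinearMap.toSpanSingleton_apply]
      refine tangent_eq_zero he hmd fun a b' => ?_
      rw [tangentCoeff_smul_torsionGen he hmd hq]
      split_ifs with h
      · exact hx _ (by omega)
      · rfl

/-- The sum of the maps from the free summand and the torsion summand of every residue class;
the residue classes are indexed by `β`. -/
noncomputable def decompositionMap {ι : Type*} [Fintype ι] (β : ι → Fin (symMult e q)) (c : ι → ℕ)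
    (hc : ∀ i, c i = torsionLength e q (β i)) :
    ((i : ι) → FiberCone (symIdeal k e q d) ×
        (FiberCone (symIdeal k e q d) ⧸ symTorsion k e q d (c i)))
      →ₗ[FiberCone (symIdeal k e q d)] TangentCone (SymRing k e q d) :=
  ∑ i, ((LinearMap.toSpanSingleton _ _ (freeGen he (β i))).coprod
    (torsionMap he hmd hq (β i) (c i) (hc i))) ∘ₗ LinearMap.proj i

theorem exists_polynomial_rep {ι : Type*} {c : ι → ℕ}
    (y : (i : ι) → FiberCone (symIdeal k e q d) ×
        (FiberCone (symIdeal k e q d) ⧸ symTorsion k e q d (c i))) :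
    ∃ p r : ι → k[X], y = fun i => (polyEquivFiber (p i),
      Ideal.Quotient.mk _ (polyEquivFiber (r i))) := by
  have h : ∀ i, ∃ p r : k[X], y i = (polyEquivFiber p, Ideal.Quotient.mk _ (polyEquivFiber r)) := by
    intro i
    obtain ⟨p, hp⟩ := polyEquivFiber.surjective (y i).1
    obtain ⟨x, hx⟩ := Ideal.Quotient.mk_surjective (y i).2
    obtain ⟨r, rfl⟩ := polyEquivFiber.surjective x
    exact ⟨p, r, Prod.ext hp.symm hx.symm⟩
  choose p r h using h
  exact ⟨p, r, funext h⟩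

variable {ι : Type*} [Fintype ι] {β : ι → Fin (symMult e q)} {c : ι → ℕ}
  (hc : ∀ i, c i = torsionLength e q (β i))

/-- Only the summands of index `i` contribute to the residue class of `β i`: the free summand for
`a ≥ β i` and the torsion summand below. -/
theorem tangentCoeff_decompositionMap (hβ : Function.Injective β) (p r : ι → k[X]) (a : ℕ) (i : ι) :
    tangentCoeff he hmd a (β i) (decompositionMap he hmd hq β c hc fun i =>
        ((polyEquivFiber (p i) : FiberCone (symIdeal k e q d)),
          Ideal.Quotient.mk _ (polyEquivFiber (r i)))) =
      if (β i : ℕ) ≤ a then (p i).coeff (a - β i) else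
        if β i - c i ≤ a then (r i).coeff (a - (β i - c i)) else 0 := by
  classical
  have h : ∀ j, tangentCoeff he hmd a (β i)
      ((polyEquivFiber (p j) : FiberCone (symIdeal k e q d)) • freeGen he (β j) +
        (polyEquivFiber (r j) : FiberCone (symIdeal k e q d)) • torsionGen he (β j)) =
      if i = j then (if (β i : ℕ) ≤ a then (p i).coeff (a - β i) else
        if β i - c i ≤ a then (r i).coeff (a - (β i - c i)) else 0) else 0 := by
    intro j
    rw [map_add, tangentCoeff_smul_freeGen, tangentCoeff_smul_torsionGen he hmd hq]
    by_cases hji : i = j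
    · subst hji
      rw [← hc, if_pos rfl]
      by_cases h1 : (β i : ℕ) ≤ a
      · rw [if_pos ⟨rfl, h1⟩, if_pos h1, if_neg (by omega), add_zero]
      · rw [if_neg (by tauto), if_neg h1, zero_add]
        refine if_congr ?_ rfl rfl
        refine ⟨fun h => h.2.1, fun h => ⟨rfl, h, by omega⟩⟩
    · rw [if_neg hji, if_neg (fun h => hji (hβ h.1)), if_neg (fun h => hji (hβ h.1)),
        add_zero]
  rw [decompositionMap, LinearMap.sum_apply, map_sum]
  refine (Finset.sum_congr rfl fun j _ => h j).trans ?_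
  classical
  rw [Finset.sum_ite_eq Finset.univ i, if_pos (Finset.mem_univ i)]

theorem decompositionMap_injective (hβ : Function.Injective β) :
    Function.Injective (decompositionMap (k := k) he hmd hq β c hc) := by
  rw [← LinearMap.ker_eq_bot, LinearMap.ker_eq_bot']
  intro y hy
  obtain ⟨p, r, rfl⟩ := exists_polynomial_rep y
  have h : ∀ i a, _ := fun i a =>
    (tangentCoeff_decompositionMap he hmd hq hc hβ p r a i).symm.trans
      ((congrArg _ hy).trans (map_zero _))
  funext i
  refine Prod.ext ?_ ?_
  · have hp : p i = 0 := by
      ext j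
      have h1 := h i (β i + j)
      rwa [if_pos (Nat.le_add_right _ _), Nat.add_sub_cancel_left] at h1
    exact (congrArg polyEquivFiber hp).trans (map_zero polyEquivFiber)
  · refine Ideal.Quotient.eq_zero_iff_mem.2 (polyEquivFiber_mem_torsion_iff.2 fun j hj => ?_)
    have h1 := h i (β i - c i + j)
    have h2 : c i ≤ β i := by have := hc i; unfold torsionLength at this; omega
    rwa [if_neg (by omega), if_pos (Nat.le_add_right _ _), Nat.add_sub_cancel_left] at h1

theorem decompositionMap_surjective (hβ : Function.Bijective β) :
    Function.Surjective (decompositionMap (k := k) he hmd hq β c hc) := by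
  intro x
  obtain ⟨N, hN⟩ := tangentCoeff_eventually_zero he hmd x
  -- the polynomial with coefficients `χ_{a + j, b}(x)`
  let P : ℕ → Fin (symMult e q) → k[X] := fun a b =>
    ∑ j ∈ Finset.range N, Polynomial.monomial j (tangentCoeff he hmd (a + j) b x)
  have hP : ∀ a b a', a ≤ a' → (P a b).coeff (a' - a) = tangentCoeff he hmd a' b x := by
    intro a b a' h
    simp only [P, Polynomial.finsetSum_coeff, Polynomial.coeff_monomial, Finset.sum_ite_eq',
      Finset.mem_range]
    rw [Nat.add_sub_cancel' h, ite_eq_left_iff]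
    exact fun h1 => (hN a' b (by omega)).symm
  refine ⟨fun i => (polyEquivFiber (P (β i) (β i)),
    Ideal.Quotient.mk _ (polyEquivFiber (P (β i - c i) (β i)))), ?_⟩
  rw [← sub_eq_zero]
  refine tangent_eq_zero he hmd fun a b => ?_
  obtain ⟨i, rfl⟩ := hβ.2 b
  rw [map_sub, sub_eq_zero, tangentCoeff_decompositionMap he hmd hq hc hβ.1
    (fun i => P (β i) (β i)) (fun i => P (β i - c i) (β i))]
  split_ifs with h1 h2
  · exact hP _ _ _ h1
  · exact hP _ _ _ h2
  · refine (tangentCoeff_eq_zero_of_not_orderGe he hmd ?_ x).symm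
    have := hc i
    unfold torsionLength at this
    unfold OrderGe
    omega

theorem decompositionMap_mem_piece_iff (hβ : Function.Bijective β) (n : ℕ)
    (y : (i : ι) → FiberCone (symIdeal k e q d) ×
        (FiberCone (symIdeal k e q d) ⧸ symTorsion k e q d (c i))) :
    decompositionMap he hmd hq β c hc y ∈ TangentCone.piece (SymRing k e q d) n ↔
      ∀ i, (y i).1 ∈ shiftPiece (FiberCone.piece (symIdeal k e q d)) (β i) n ∧
        (y i).2 ∈ shiftPiece (FiberCone.quotPiece (symTorsion k e q d (c i)))
          (β i - c i - q) n := by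
  obtain ⟨p, r, rfl⟩ := exists_polynomial_rep y
  rw [mem_tangentPiece_iff he hmd]
  have hcb : ∀ i, c i ≠ 0 → q + 1 + c i ≤ β i := by
    intro i
    have := hc i; unfold torsionLength at this; omega
  have h := tangentCoeff_decompositionMap he hmd hq hc hβ.1 p r
  simp only [polyEquivFiber_mem_shiftPiece_iff, polyEquivFiber_mem_shiftPiece_quotPiece_iff]
  constructor
  · intro hy i
    refine ⟨fun j hj => ?_, fun j hj hjn => ?_⟩
    · have h1 := hy (β i + j) (β i) (by rwa [symOrder, if_pos (Nat.le_add_right _ _)])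
      rwa [h, if_pos (Nat.le_add_right _ _), Nat.add_sub_cancel_left] at h1
    · have h2 := hcb i (by omega)
      have h1 := hy (β i - c i + j) (β i) (by rw [symOrder, if_neg (by omega)]; omega)
      rwa [h, if_neg (by omega), if_pos (Nat.le_add_right _ _), Nat.add_sub_cancel_left] at h1
  · intro hy a b hab
    obtain ⟨i, rfl⟩ := hβ.2 b
    rw [h]
    unfold symOrder at hab
    split_ifs at hab ⊢ with h1 h2
    · exact (hy i).1 _ (by omega)
    · have := hcb i (by omega)
      exact (hy i).2 _ (by omega) (by omega)
    · rfl

/-- The class of `t^{(q+1)m+(q+2)d}` is a nonzero torsion element of the tangent cone. -/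
theorem tangentCone_not_free (he : 4 ≤ e) (hmd : Nat.gcd (symMult e q) d = 1) (hq : 1 ≤ q) :
    ¬ Module.Free (FiberCone (symIdeal k e q d)) (TangentCone (SymRing k e q d)) := by
  intro hfree
  let b : Fin (symMult e q) := ⟨q + 2, by unfold symMult; omega⟩
  have hl : torsionLength e q b = 1 := by
    change min (q + 2 - (q + 1)) (e - 2) = 1
    omega
  have h0 : (polyEquivFiber X : FiberCone (symIdeal k e q d)) •
      (torsionGen he b : TangentCone (SymRing k e q d)) = 0 := by
    refine tangent_eq_zero he hmd fun a b' => ?_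
    rw [tangentCoeff_smul_torsionGen he hmd hq, hl]
    split_ifs with h
    · have : a - (b - 1) = 0 := by omega
      rw [this, Polynomial.coeff_X_zero]
    · rfl
  have h1 : (torsionGen he b : TangentCone (SymRing k e q d)) ≠ 0 := by
    intro h
    have h2 := tangentCoeff_smul_torsionGen he hmd hq b (1 : k[X]) (b - 1) b
    rw [h, smul_zero, map_zero, hl, if_pos ⟨rfl, le_rfl, Nat.sub_lt (Nat.succ_pos _) one_pos⟩,
      Nat.sub_self, Polynomial.coeff_one_zero] at h2
    exact zero_ne_one h2
  have : IsDomain (FiberCone (symIdeal k e q d)) :=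
    (polyEquivFiber (k := k)).symm.toMulEquiv.isDomain k[X]
  refine h1 ((smul_eq_zero_iff_right ?_).1 h0)
  exact (map_ne_zero_iff _ (RingEquiv.injective _)).2 Polynomial.X_ne_zero

end Decomposition

/-! ### The four families of residue classes -/

section Residues

variable {e q : ℕ}

/-- The index set of the residue classes modulo `m`, in the order in which they contribute to the
decomposition: `b = 0`, then `1 ≤ b ≤ q + 1`, then the `q + 2` classes `b ≥ e + q - 1`, and then the
`e - 3` classes `q + 2 ≤ b ≤ e + q - 2`. -/
abbrev ResidueIndex (e q : ℕ) : Type := Unit ⊕ Fin (q + 1) ⊕ Fin (q + 2) ⊕ Fin (e - 3)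

/-- The residue `b` with index `i`; it is also the shift of the free summand. -/
def residueNat (e q : ℕ) : ResidueIndex e q → ℕ
  | .inl _ => 0
  | .inr (.inl i) => i + 1
  | .inr (.inr (.inl i)) => e + q + (i + 1) - 2
  | .inr (.inr (.inr i)) => q + (i + 1) + 1

/-- The length of the torsion summand with index `i`. -/
def residueLength (e q : ℕ) : ResidueIndex e q → ℕ
  | .inl _ => 0
  | .inr (.inl _) => 0
  | .inr (.inr (.inl _)) => e - 2
  | .inr (.inr (.inr i)) => i + 1

theorem residueNat_lt (he : 4 ≤ e) (i : ResidueIndex e q) : residueNat e q i < symMult e q := by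
  rcases i with _ | i | i | i <;> simp only [residueNat, symMult] <;> omega

/-- The residue with index `i`, as an element of `Fin m`. -/
def residue (he : 4 ≤ e) (i : ResidueIndex e q) : Fin (symMult e q) :=
  ⟨residueNat e q i, residueNat_lt he i⟩

theorem residue_bijective (he : 4 ≤ e) : Function.Bijective (residue (q := q) he) := by
  constructor
  · intro i j hij
    have h : residueNat e q i = residueNat e q j := congrArg Fin.val hij
    rcases i with _ | i | i | i <;> rcases j with _ | j | j | j <;>
      simp only [residueNat] at h <;>
      first
      | rfl
      | (exfalso; omega)
      | (have hij' : i = j := Fin.ext (by omega)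
         rw [hij'])
  · rintro ⟨b, hb⟩
    unfold symMult at hb
    by_cases h0 : b = 0
    · exact ⟨.inl (), Fin.ext h0.symm⟩
    by_cases h1 : b ≤ q + 1
    · exact ⟨.inr (.inl ⟨b - 1, by omega⟩), Fin.ext (by
        change b - 1 + 1 = b
        omega)⟩
    by_cases h2 : b ≤ e + q - 2
    · exact ⟨.inr (.inr (.inr ⟨b - (q + 2), by omega⟩)), Fin.ext (by
        change q + (b - (q + 2) + 1) + 1 = b
        omega)⟩
    · exact ⟨.inr (.inr (.inl ⟨b - (e + q - 1), by omega⟩)), Fin.ext (by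
        change e + q + (b - (e + q - 1) + 1) - 2 = b
        omega)⟩

theorem residueLength_eq (he : 4 ≤ e) (i : ResidueIndex e q) :
    residueLength e q i = torsionLength e q (residue he i) := by
  change _ = torsionLength e q (residueNat e q i)
  rcases i with _ | i | i | i <;> simp only [residueNat, residueLength, torsionLength] <;> omega

end Residues

section Reindex

variable (k : Type*) [Field k] (e q d : ℕ)

theorem subsingleton_quotient_symTorsion_zero :
    Subsingleton (FiberCone (symIdeal k e q d) ⧸ symTorsion k e q d 0) := by
  rw [Ideal.Quotient.subsingleton_iff, symTorsion, pow_zero, Ideal.span_singleton_one]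

/-- A family indexed by all residue classes, with its trivial torsion components left out. -/
noncomputable def residueEquiv :
    ((i : ResidueIndex e q) → FiberCone (symIdeal k e q d) ×
        (FiberCone (symIdeal k e q d) ⧸ symTorsion k e q d (residueLength e q i)))
      ≃ₗ[FiberCone (symIdeal k e q d)]
        FiberCone (symIdeal k e q d) ×
        (Fin (q + 1) → FiberCone (symIdeal k e q d)) ×
        (Fin (q + 2) → FiberCone (symIdeal k e q d) ×
          (FiberCone (symIdeal k e q d) ⧸ symTorsion k e q d (e - 2))) ×
        ((i : Fin (e - 3)) → FiberCone (symIdeal k e q d) ×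
          (FiberCone (symIdeal k e q d) ⧸ symTorsion k e q d ((i : ℕ) + 1))) where
  toFun y := ((y (.inl ())).1, fun i => (y (.inr (.inl i))).1, fun i => y (.inr (.inr (.inl i))),
    fun i => y (.inr (.inr (.inr i))))
  invFun z
    | .inl _ => (z.1, 0)
    | .inr (.inl i) => (z.2.1 i, 0)
    | .inr (.inr (.inl i)) => z.2.2.1 i
    | .inr (.inr (.inr i)) => z.2.2.2 i
  map_add' _ _ := rfl
  map_smul' _ _ := rfl
  left_inv y := by
    have := subsingleton_quotient_symTorsion_zero k e q d
    funext i
    rcases i with _ | i | i | i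
    · exact Prod.ext rfl (Subsingleton.elim (α := _ ⧸ symTorsion k e q d 0) _ _)
    · exact Prod.ext rfl (Subsingleton.elim (α := _ ⧸ symTorsion k e q d 0) _ _)
    · rfl
    · rfl
  right_inv _ := rfl

end Reindex

theorem mainTheorem3 {k : Type*} [Field k] (e q d : ℕ) (he : 4 ≤ e) (hq : 1 ≤ q) (hd : 1 ≤ d)
    (hmd : Nat.gcd (symMult e q) d = 1) :
    ¬ Module.Free (FiberCone (symIdeal k e q d)) (TangentCone (SymRing k e q d)) ∧
    ∃ φ : TangentCone (SymRing k e q d) ≃ₗ[FiberCone (symIdeal k e q d)]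
        FiberCone (symIdeal k e q d) ×
        (Fin (q + 1) → FiberCone (symIdeal k e q d)) ×
        (Fin (q + 2) → FiberCone (symIdeal k e q d) ×
          (FiberCone (symIdeal k e q d) ⧸ symTorsion k e q d (e - 2))) ×
        ((i : Fin (e - 3)) → FiberCone (symIdeal k e q d) ×
          (FiberCone (symIdeal k e q d) ⧸ symTorsion k e q d ((i : ℕ) + 1))),
      ∀ (n : ℕ) (x : TangentCone (SymRing k e q d)),
        x ∈ TangentCone.piece (SymRing k e q d) n ↔
          (φ x).1 ∈ FiberCone.piece (symIdeal k e q d) n ∧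
          (∀ i : Fin (q + 1), (φ x).2.1 i ∈
            shiftPiece (FiberCone.piece (symIdeal k e q d)) ((i : ℕ) + 1) n) ∧
          (∀ i : Fin (q + 2),
            ((φ x).2.2.1 i).1 ∈
              shiftPiece (FiberCone.piece (symIdeal k e q d)) (e + q + ((i : ℕ) + 1) - 2) n ∧
            ((φ x).2.2.1 i).2 ∈
              shiftPiece (FiberCone.quotPiece (symTorsion k e q d (e - 2))) ((i : ℕ) + 1) n) ∧
          (∀ i : Fin (e - 3),
            ((φ x).2.2.2 i).1 ∈
              shiftPiece (FiberCone.piece (symIdeal k e q d)) (q + ((i : ℕ) + 1) + 1) n ∧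
            ((φ x).2.2.2 i).2 ∈
              shiftPiece (FiberCone.quotPiece (symTorsion k e q d ((i : ℕ) + 1))) 1 n) := by
  refine ⟨tangentCone_not_free he hmd hq, ?_⟩
  have hβ := residue_bijective (q := q) he
  let Ψ := LinearEquiv.ofBijective
    (decompositionMap (k := k) he hmd hq (residue he) (residueLength e q) (residueLength_eq he))
    ⟨decompositionMap_injective he hmd hq _ hβ.1, decompositionMap_surjective he hmd hq _ hβ⟩
  refine ⟨Ψ.symm.trans (residueEquiv k e q d), fun n x => ?_⟩
  obtain ⟨y, rfl⟩ := Ψ.surjective x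
  rw [LinearEquiv.trans_apply, LinearEquiv.symm_apply_apply]
  refine (decompositionMap_mem_piece_iff he hmd hq (residueLength_eq he) hβ n y).trans ?_
  have hshift : ∀ {c s s' : ℕ} {z : FiberCone (symIdeal k e q d) ⧸ symTorsion k e q d c},
      s = s' → z ∈ shiftPiece (FiberCone.quotPiece (symTorsion k e q d c)) s n →
        z ∈ shiftPiece (FiberCone.quotPiece (symTorsion k e q d c)) s' n := by
    rintro c s _ z rfl h
    exact h
  -- the shifts of the two families of nontrivial torsion summands
  have hs3 : ∀ i : Fin (q + 2), e + q + ((i : ℕ) + 1) - 2 - (e - 2) - q = i + 1 := by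
    intro i; omega
  have hs4 : ∀ i : Fin (e - 3), q + ((i : ℕ) + 1) + 1 - (i + 1) - q = 1 := by
    intro i; omega
  have htriv : ∀ (s : ℕ) (z : FiberCone (symIdeal k e q d) ⧸ symTorsion k e q d 0),
      z ∈ shiftPiece (FiberCone.quotPiece (symTorsion k e q d 0)) s n := by
    intro s z
    have := subsingleton_quotient_symTorsion_zero k e q d
    rw [Subsingleton.elim z 0]
    exact zero_mem _
  have h0 : ∀ z : FiberCone (symIdeal k e q d),
      z ∈ shiftPiece (FiberCone.piece (symIdeal k e q d)) 0 n ↔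
        z ∈ FiberCone.piece (symIdeal k e q d) n := by
    intro z
    rw [shiftPiece, if_pos (Nat.zero_le _), Nat.sub_zero]
  constructor
  · intro h
    refine ⟨(h0 _).1 (h (.inl ())).1, fun i => (h (.inr (.inl i))).1, fun i => ?_, fun i => ?_⟩
    · have h3 := h (.inr (.inr (.inl i)))
      exact ⟨h3.1, hshift (hs3 i) h3.2⟩
    · have h4 := h (.inr (.inr (.inr i)))
      exact ⟨h4.1, hshift (hs4 i) h4.2⟩
  · rintro ⟨h1, h2, h3, h4⟩ (i | i | i | i)
    · exact ⟨(h0 _).2 h1, htriv _ _⟩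
    · exact ⟨h2 i, htriv _ _⟩
    · exact ⟨(h3 i).1, hshift (hs3 i).symm (h3 i).2⟩
    · exact ⟨(h4 i).1, hshift (hs4 i).symm (h4 i).2⟩
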